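/- **Theorem (symmetric implies primitive).** Let $n\ge 0$, $N=2^n$, and let $G_N=G_2^{\otimes n}$ be the $n$-fold Kronecker power over $\mathbb F_2$ of $G_2=\begin{bmatrix}1&0\\1&1\end{bmatrix}$. A *puncturing pattern* is a vector $P=(P(0),\dots,P(N-1))\in\{0,1\}^N$. *Erasure pattern.* Let $W$ be a binary-input memoryless channel, i.e. a pair of probability measures $W(\cdot\mid 0),W(\cdot\mid 1)$ on an arbitrary measurable space $\mathcal Y$ (in particular, any B-DMC), with symmetric capacity (mutual information between a uniform input and the output) $\mathcal I(W)>0$. A data vector $u\in\mathbb F_2^N$ is encoded as $x=u\cdot G_N$ and sent over $W$; the received symbol at position $j$ is an additional erasure symbol $\star\notin\mathcal Y$ if $P(j)=1$, and is the output of $W$ with input $x_j$ if $P(j)=0$; this gives the received sequence $y[P]\in(\mathcal Y\cup\{\star\})^N$. For $0\le i<N$ let $W[P]^{(i)}_N$ be the virtual channel with input $u_i$ and output $(y[P],u_0,\dots,u_{i-1})$, where the data bits other than $u_i$ are independent and uniform. The erasure pattern $E[P]\in\{0,1\}^N$ is defined by $E[P](i)=1$ if and only if $\mathcal I(W[P]^{(i)}_N)=0$.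 The pattern $P$ is *symmetric* (with respect to $W$) if $E[P]=P$. *Primitive patterns.* For a map $f$ of $\{0,\dots,N-1\}$ to itself and a pattern $A$, let $f(A)(i)=A(f(i))$. Let $B_N$ be the bit-reversal permutation of $\{0,\dots,N-1\}$. For $0\le j<n$ and $k\in\{0,2^{j+1},2\cdot 2^{j+1},\dots,N-2^{j+1}\}$, let the elementary permutation $\phi_{k,j}$ swap the blocks $[k,\dots,k+2^j-1]$ and $[k+2^j,\dots,k+2^{j+1}-1]$ (keeping the order inside each block) and fix all other positions. Patterns $P,P'$ are *equivalent*, $P\approx P'$, if $P'=B_N(\phi_{k_t,j_t}(\cdots\phi_{k_1,j_1}(B_N(P))\cdots))$ for some finite (possibly empty) sequence of elementary permutations. Let $\phi(A)$ be the result of the following procedure: for $j=0,1,\dots,n-1$, and for each $j$ successively for $k=0,2^{j+1},\dots,N-2^{j+1}$, replace the current pattern $A$ by $\phi_{k,j}(A)$ if $[A(k),\dots,A(k+2^j-1)]<_{lex}[A(k+2^j),\dots,A(k+2^{j+1}-1)]$, and leave it unchanged otherwise. Put $\Phi(P)=B_N(\phi(B_N(P)))$, and call $P$ *primitive* if $\Phi(P)=P$.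 *Claim.* Every symmetric puncturing pattern $P$ is primitive, that is, $\Phi(P)=P$; and $P$ is the primitive pattern of its equivalence class, that is, every primitive pattern $P'\approx P$ is equal to $P$. -/

import Mathlib

open MeasureTheory

open scoped ENNReal Kronecker Matrix

namespace PolarCode

/-- A puncturing pattern of length `N = 2 ^ n`: position `i` is punctured iff the value is `true`. -/
abbrev Pattern (n : ℕ) : Type := Fin (2 ^ n) → Bool

/-! ### The generator matrix -/

/-- The kernel matrix `G₂` over the field with two elements. -/
def kernelMatrix : Matrix (Fin 2) (Fin 2) (ZMod 2) := !![1, 0; 1, 1]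

/-- The generator matrix `G_N = G₂ ⊗ ⋯ ⊗ G₂` (`n` factors), with `N = 2 ^ n`. The pair of indices
`(a, r)` of the Kronecker product `G₂ ⊗ G_{N/2}` is the index `a * (N/2) + r`. -/
def genMatrix : (n : ℕ) → Matrix (Fin (2 ^ n)) (Fin (2 ^ n)) (ZMod 2)
  | 0 => 1
  | n + 1 =>
    Matrix.reindex (finProdFinEquiv.trans (finCongr (pow_succ' 2 n).symm))
      (finProdFinEquiv.trans (finCongr (pow_succ' 2 n).symm))
      (kernelMatrix ⊗ₖ genMatrix n)

/-! ### Punctured transmission, virtual channels, erasure pattern -/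

section Channel

variable {Y : Type*} [MeasurableSpace Y]

/-- The symmetric capacity, in bits, of the binary-input channel `W` with transition laws `W 0` and
`W 1`: the mutual information between a uniform input bit and the corresponding output, that is
`∑ x, (1/2) * D(W x ‖ (W 0 + W 1)/2)` with `D` the Kullback-Leibler divergence to base `2`. -/
noncomputable def symCapacity (W : ZMod 2 → Measure Y) : ℝ≥0∞ :=
  (∑ x : ZMod 2, 2⁻¹ * InformationTheory.klDiv (W x) ((2⁻¹ : ℝ≥0∞) • (W 0 + W 1))) /
    ENNReal.ofReal (Real.log 2)

/-- The law of one received symbol when the code bit `x` is sent over `W`, the position being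
punctured iff `p = true`. The output alphabet is extended by one symbol, `Sum.inr ()`, which is
received exactly at the punctured positions. -/
noncomputable def puncturedLaw (W : ZMod 2 → Measure Y) (p : Bool) (x : ZMod 2) :
    Measure (Y ⊕ Unit) :=
  if p then Measure.dirac (Sum.inr ()) else (W x).map Sum.inl

/-- The law of the punctured received sequence when the data vector `u` is encoded as `u · G_N`
and sent over the memoryless channel `W`. -/
noncomputable def receivedLaw (W : ZMod 2 → Measure Y) {n : ℕ} (P : Pattern n)
    (u : Fin (2 ^ n) → ZMod 2) : Measure (Fin (2 ^ n) → Y ⊕ Unit) :=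
  Measure.pi fun j => puncturedLaw W (P j) ((u ᵥ* genMatrix n) j)

/-- The `i`-th virtual channel: its input is the data bit `u i`, its output is the punctured
received sequence together with the preceding data bits, and the data bits other than `u i` are
independent and uniform. -/
noncomputable def virtualChannel (W : ZMod 2 → Measure Y) {n : ℕ} (P : Pattern n)
    (i : Fin (2 ^ n)) (b : ZMod 2) :
    Measure ((Fin (2 ^ n) → Y ⊕ Unit) × ({j : Fin (2 ^ n) // j < i} → ZMod 2)) :=
  ((2 : ℝ≥0∞) ^ (2 ^ n - 1))⁻¹ •
    ∑ u : Fin (2 ^ n) → ZMod 2 with u i = b,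
      (receivedLaw W P u).prod (Measure.dirac fun j : {j // j < i} => u j)

open Classical in
/-- The data bit erasure pattern `E[P]` (for the channel `W`): it marks the positions whose virtual
channel has symmetric capacity zero. -/
noncomputable def erasurePattern (W : ZMod 2 → Measure Y) {n : ℕ} (P : Pattern n) : Pattern n :=
  fun i => decide (symCapacity (virtualChannel W P i) = 0)

/-- `P` is symmetric if `E[P] = P`. -/
def IsSymmetric (W : ZMod 2 → Measure Y) {n : ℕ} (P : Pattern n) : Prop :=
  erasurePattern W P = P

end Channel

/-! ### Equivalent and primitive patterns -/

/-- The bit-reversal permutation `B_N` of `{0, …, N - 1}`, `N = 2 ^ n`: the number with binary digits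
`d 0, …, d (n - 1)` (least significant first) is sent to the number with digits
`d (n - 1), …, d 0`. -/
def bitReversal (n : ℕ) : Equiv.Perm (Fin (2 ^ n)) :=
  finFunctionFinEquiv.symm.trans
    ((Equiv.arrowCongr Fin.revPerm (Equiv.refl (Fin 2))).trans finFunctionFinEquiv)

/-- The action of a permutation `f` of the positions: `f(A)(i) = A(f(i))`. -/
def permute {n : ℕ} (f : Fin (2 ^ n) → Fin (2 ^ n)) (A : Pattern n) : Pattern n :=
  fun i => A (f i)

/-- The starting positions `k = m * 2 ^ (j + 1)` run over `0, 2 ^ (j + 1), …, N - 2 ^ (j + 1)`. -/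
theorem block_le {n : ℕ} (j : Fin n) (m : Fin (2 ^ (n - 1 - j))) :
    m.1 * 2 ^ (j.1 + 1) + 2 ^ (j.1 + 1) ≤ 2 ^ n := by
  have hj := j.2
  have h : 2 ^ n = 2 ^ (n - 1 - j.1) * 2 ^ (j.1 + 1) := by
    rw [← pow_add]
    congr 1
    omega
  calc m.1 * 2 ^ (j.1 + 1) + 2 ^ (j.1 + 1) = (m.1 + 1) * 2 ^ (j.1 + 1) := by ring
    _ ≤ 2 ^ (n - 1 - j.1) * 2 ^ (j.1 + 1) := Nat.mul_le_mul_right _ m.2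
    _ = 2 ^ n := h.symm

/-- The elementary permutation `φ_{k,j}`, with `k = m * 2 ^ (j + 1)`: it swaps the blocks
`[k, k + 2 ^ j - 1]` and `[k + 2 ^ j, k + 2 ^ (j + 1) - 1]`. -/
def elemPerm {n : ℕ} (j : Fin n) (m : Fin (2 ^ (n - 1 - j))) (i : Fin (2 ^ n)) : Fin (2 ^ n) :=
  if i.1 < m.1 * 2 ^ (j.1 + 1) ∨ m.1 * 2 ^ (j.1 + 1) + 2 ^ (j.1 + 1) ≤ i.1 then i
  else if h : i.1 < m.1 * 2 ^ (j.1 + 1) + 2 ^ j.1 then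
    ⟨i.1 + 2 ^ j.1, by
      have := block_le j m
      have h2 : 2 ^ (j.1 + 1) = 2 ^ j.1 + 2 ^ j.1 := by ring
      omega⟩
  else ⟨i.1 - 2 ^ j.1, lt_of_le_of_lt (Nat.sub_le _ _) i.2⟩

/-- The patterns `P` and `P'` are equivalent if
`P' = B_N(φ_{k_t,j_t}(⋯ φ_{k_1,j_1}(B_N(P)) ⋯))` for a finite sequence of elementary
permutations. -/
def Equivalent {n : ℕ} (P P' : Pattern n) : Prop :=
  ∃ L : List (Σ j : Fin n, Fin (2 ^ (n - 1 - j))),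
    P' = permute (bitReversal n)
      (L.foldl (fun A s => permute (elemPerm s.1 s.2) A) (permute (bitReversal n) P))

/-- The strict lexicographic order `a <_lex b` of binary vectors. -/
def LexLT {l : ℕ} (a b : Fin l → Bool) : Prop :=
  ∃ i, (∀ j < i, a j = b j) ∧ a i < b i

instance instDecidableLexLT {l : ℕ} (a b : Fin l → Bool) : Decidable (LexLT a b) := by
  unfold LexLT
  infer_instance

/-- The block `[P(k), …, P(k + 2 ^ j - 1)]`, `k = m * 2 ^ (j + 1)`. -/
def leftBlock {n : ℕ} (j : Fin n) (m : Fin (2 ^ (n - 1 - j))) (P : Pattern n) :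
    Fin (2 ^ j.1) → Bool :=
  fun r => P ⟨m.1 * 2 ^ (j.1 + 1) + r.1, by
    have := block_le j m
    have h2 : 2 ^ (j.1 + 1) = 2 ^ j.1 + 2 ^ j.1 := by ring
    have := r.2
    omega⟩

/-- The block `[P(k + 2 ^ j), …, P(k + 2 ^ (j + 1) - 1)]`, `k = m * 2 ^ (j + 1)`. -/
def rightBlock {n : ℕ} (j : Fin n) (m : Fin (2 ^ (n - 1 - j))) (P : Pattern n) :
    Fin (2 ^ j.1) → Bool :=
  fun r => P ⟨m.1 * 2 ^ (j.1 + 1) + 2 ^ j.1 + r.1, by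
    have := block_le j m
    have h2 : 2 ^ (j.1 + 1) = 2 ^ j.1 + 2 ^ j.1 := by ring
    have := r.2
    omega⟩

/-- One step of the algorithm: the two blocks are swapped iff the left one is lexicographically
smaller than the right one. -/
def sortStep {n : ℕ} (j : Fin n) (m : Fin (2 ^ (n - 1 - j))) (P : Pattern n) : Pattern n :=
  if LexLT (leftBlock j m P) (rightBlock j m P) then permute (elemPerm j m) P else P

/-- The algorithm `φ`: for `j = 0, …, n - 1` and then for `k = 0, 2 ^ (j + 1), …, N - 2 ^ (j + 1)`,
in this order, perform the step for `(k, j)`. -/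
def sortPattern {n : ℕ} (P : Pattern n) : Pattern n :=
  (List.finRange n).foldl
    (fun Q j => (List.finRange (2 ^ (n - 1 - j.1))).foldl (fun R m => sortStep j m R) Q) P

/-- `Φ(P) = B_N(φ(B_N(P)))`. -/
def Phi {n : ℕ} (P : Pattern n) : Pattern n :=
  permute (bitReversal n) (sortPattern (permute (bitReversal n) P))

/-- `P` is primitive if `Φ(P) = P`. -/
def IsPrimitive {n : ℕ} (P : Pattern n) : Prop :=
  Phi P = P

end PolarCode

namespace PolarCode

/-! ### The lexicographic order -/

/-! Everything is an induction on `n` that splits a pattern into its entries at even and odd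
positions.

For the erasure pattern this split is the polar butterfly: `x = u · G_N` consists of the codeword of
`u_e + u_o` at even positions and the codeword of `u_o` at odd positions. A virtual channel has
capacity zero iff its two laws agree, and it suffices to compare them on product events, where they
become the sums `prefixSum`. At an odd position such a sum is a product `a(x + y) b(y)`; at the
preceding even position it is summed over `y`, and its difference in `x` is `(a 0 - a 1)(b 0 - b
1)`. Hence `E[P]` is the OR of the two smaller erasure patterns at even positions and their AND at
odd positions (`noInfluence_evenPos`, `noInfluence_oddPos`).

Since `(a OR b) + (a AND b) = a + b`, `E[P]` and `P` have the same weight. If `E[P] = P`, the even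
part of `P` dominates its own erasure pattern and the odd part is dominated by its own; equal
weights force equality. So both parts are symmetric, and the odd part lies pointwise below the even
one (`IsSymmetric.parts`).

Bit reversal turns even and odd parts into left and right halves. The algorithm sorts each half and
then orders the two results (`sortPattern_joinHalves`). By induction the halves are already sorted,
and pointwise domination excludes a final swap, so `P` is primitive. The same recursion makes `Φ`
invariant under elementary permutations, so a class contains at most one primitive pattern. -/

theorem not_lexLT_of_le {l : ℕ} {a b : Fin l → Bool} (h : ∀ i, b i ≤ a i) : ¬ LexLT a b := by
  rintro ⟨i, -, hi⟩
  exact absurd (h i) (not_le_of_gt hi)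

/-! ### Concatenation of two patterns -/

/-- The concatenation of two patterns of the same length. -/
def joinHalves {n : ℕ} (A B : Pattern n) : Pattern (n + 1) := fun i =>
  if h : i.1 < 2 ^ n then A ⟨i.1, h⟩
  else B ⟨i.1 - 2 ^ n, by have := i.2; have := pow_succ 2 n; omega⟩

/-- The position `i` of the left half. -/
def lowPos {n : ℕ} (i : Fin (2 ^ n)) : Fin (2 ^ (n + 1)) :=
  ⟨i.1, by have := i.2; have := pow_succ 2 n; omega⟩

/-- The position `i` of the right half. -/
def highPos {n : ℕ} (i : Fin (2 ^ n)) : Fin (2 ^ (n + 1)) :=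
  ⟨2 ^ n + i.1, by have := i.2; have := pow_succ 2 n; omega⟩

@[simp] theorem joinHalves_lowPos {n : ℕ} (A B : Pattern n) (i : Fin (2 ^ n)) :
    joinHalves A B (lowPos i) = A i := by
  simp [joinHalves, lowPos]

@[simp] theorem joinHalves_highPos {n : ℕ} (A B : Pattern n) (i : Fin (2 ^ n)) :
    joinHalves A B (highPos i) = B i := by
  simp [joinHalves, highPos]

theorem joinHalves_comp {n : ℕ} (P : Pattern (n + 1)) :
    joinHalves (fun i => P (lowPos i)) (fun i => P (highPos i)) = P := by
  funext i
  by_cases h : i.1 < 2 ^ n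
  · simp [joinHalves, h, lowPos]
  · simp only [joinHalves, h, dite_false, highPos]
    congr 1
    apply Fin.ext
    simp only
    omega

theorem joinHalves_inj {n : ℕ} {A B A' B' : Pattern n} :
    joinHalves A B = joinHalves A' B' ↔ A = A' ∧ B = B' := by
  constructor
  · intro h
    refine ⟨funext fun i => ?_, funext fun i => ?_⟩
    · simpa using congrFun h (lowPos i)
    · simpa using congrFun h (highPos i)
  · rintro ⟨rfl, rfl⟩
    rfl

/-! ### Blocks and elementary steps inside one half -/

theorem two_pow_blocks {n : ℕ} (j : Fin n) :
    2 ^ (n + 1 - 1 - j.castSucc.1) = 2 ^ (n - 1 - j.1) + 2 ^ (n - 1 - j.1) := by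
  have := j.2
  have h : n + 1 - 1 - j.castSucc.1 = (n - 1 - j.1) + 1 := by simp only [Fin.val_castSucc]; omega
  rw [h, pow_succ]
  ring

/-- The block number of a block in the left half. -/
def lowBlock {n : ℕ} (j : Fin n) (m : Fin (2 ^ (n - 1 - j.1))) :
    Fin (2 ^ (n + 1 - 1 - j.castSucc.1)) :=
  Fin.cast (two_pow_blocks j).symm (Fin.castAdd _ m)

/-- The block number of a block in the right half. -/
def highBlock {n : ℕ} (j : Fin n) (m : Fin (2 ^ (n - 1 - j.1))) :
    Fin (2 ^ (n + 1 - 1 - j.castSucc.1)) :=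
  Fin.cast (two_pow_blocks j).symm (Fin.natAdd _ m)

theorem highBlock_mul {n : ℕ} (j : Fin n) (m : Fin (2 ^ (n - 1 - j.1))) :
    (highBlock j m).1 * 2 ^ (j.1 + 1) = 2 ^ n + m.1 * 2 ^ (j.1 + 1) := by
  have hj := j.2
  have h : 2 ^ n = 2 ^ (n - 1 - j.1) * 2 ^ (j.1 + 1) := by
    rw [← pow_add]
    congr 1
    omega
  simp only [highBlock, Fin.val_cast, Fin.val_natAdd, add_mul, ← h]

theorem lowBlock_or_highBlock {n : ℕ} (j : Fin n) (m : Fin (2 ^ (n + 1 - 1 - j.castSucc.1))) :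
    (∃ m', m = lowBlock j m') ∨ ∃ m', m = highBlock j m' := by
  obtain ⟨m, rfl⟩ := (finCongr (two_pow_blocks j).symm).surjective m
  induction m using Fin.addCases with
  | left m => exact Or.inl ⟨m, rfl⟩
  | right m => exact Or.inr ⟨m, rfl⟩

theorem val_elemPerm {n : ℕ} (j : Fin n) (m : Fin (2 ^ (n - 1 - j.1))) (i : Fin (2 ^ n)) :
    (elemPerm j m i).1 =
      if i.1 < m.1 * 2 ^ (j.1 + 1) ∨ m.1 * 2 ^ (j.1 + 1) + 2 ^ (j.1 + 1) ≤ i.1 then i.1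
      else if i.1 < m.1 * 2 ^ (j.1 + 1) + 2 ^ j.1 then i.1 + 2 ^ j.1 else i.1 - 2 ^ j.1 := by
  unfold elemPerm
  split_ifs <;> rfl

theorem eq_joinHalves {n : ℕ} {P : Pattern (n + 1)} {A B : Pattern n}
    (hA : ∀ i, P (lowPos i) = A i) (hB : ∀ i, P (highPos i) = B i) : P = joinHalves A B := by
  rw [← joinHalves_comp P, joinHalves_inj]
  exact ⟨funext hA, funext hB⟩

theorem permute_lowBlock {n : ℕ} (j : Fin n) (m : Fin (2 ^ (n - 1 - j.1))) (A B : Pattern n) :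
    permute (elemPerm j.castSucc (lowBlock j m)) (joinHalves A B) =
      joinHalves (permute (elemPerm j m) A) B := by
  have hb := block_le j m
  have hl : (lowBlock j m).1 = m.1 := rfl
  refine eq_joinHalves (fun i => ?_) (fun i => ?_)
  · rw [permute, permute, ← joinHalves_lowPos A B]
    congr 1
    apply Fin.ext
    simp only [val_elemPerm, lowPos, Fin.val_castSucc, hl]
  · rw [permute, ← joinHalves_highPos A B]
    congr 1
    apply Fin.ext
    have := m.2
    rw [val_elemPerm]
    simp only [highPos, Fin.val_castSucc, hl]
    split_ifs <;> omega

theorem permute_highBlock {n : ℕ} (j : Fin n) (m : Fin (2 ^ (n - 1 - j.1))) (A B : Pattern n) :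
    permute (elemPerm j.castSucc (highBlock j m)) (joinHalves A B) =
      joinHalves A (permute (elemPerm j m) B) := by
  have hb := block_le j m
  have hh := highBlock_mul j m
  refine eq_joinHalves (fun i => ?_) (fun i => ?_)
  · rw [permute, ← joinHalves_lowPos A B]
    congr 1
    apply Fin.ext
    have := i.2
    rw [val_elemPerm]
    simp only [lowPos, Fin.val_castSucc, hh]
    split_ifs <;> omega
  · rw [permute, permute, ← joinHalves_highPos A B]
    congr 1
    apply Fin.ext
    have h2 : 2 ^ (j.1 + 1) = 2 ^ j.1 + 2 ^ j.1 := by ring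
    rw [val_elemPerm]
    simp only [highPos, Fin.val_castSucc, hh, val_elemPerm]
    split_ifs <;> omega

theorem leftBlock_lowBlock {n : ℕ} (j : Fin n) (m : Fin (2 ^ (n - 1 - j.1))) (A B : Pattern n) :
    leftBlock j.castSucc (lowBlock j m) (joinHalves A B) = leftBlock j m A := by
  funext r
  rw [leftBlock, leftBlock, ← joinHalves_lowPos A B]
  rfl

theorem rightBlock_lowBlock {n : ℕ} (j : Fin n) (m : Fin (2 ^ (n - 1 - j.1))) (A B : Pattern n) :
    rightBlock j.castSucc (lowBlock j m) (joinHalves A B) = rightBlock j m A := by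
  funext r
  rw [rightBlock, rightBlock, ← joinHalves_lowPos A B]
  rfl

theorem leftBlock_highBlock {n : ℕ} (j : Fin n) (m : Fin (2 ^ (n - 1 - j.1))) (A B : Pattern n) :
    leftBlock j.castSucc (highBlock j m) (joinHalves A B) = leftBlock j m B := by
  funext r
  rw [leftBlock, leftBlock, ← joinHalves_highPos A B]
  congr 1
  apply Fin.ext
  have := highBlock_mul j m
  simp only [highPos, Fin.val_castSucc]
  omega

theorem rightBlock_highBlock {n : ℕ} (j : Fin n) (m : Fin (2 ^ (n - 1 - j.1))) (A B : Pattern n) :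
    rightBlock j.castSucc (highBlock j m) (joinHalves A B) = rightBlock j m B := by
  funext r
  rw [rightBlock, rightBlock, ← joinHalves_highPos A B]
  congr 1
  apply Fin.ext
  have := highBlock_mul j m
  simp only [highPos, Fin.val_castSucc]
  omega

theorem sortStep_lowBlock {n : ℕ} (j : Fin n) (m : Fin (2 ^ (n - 1 - j.1))) (A B : Pattern n) :
    sortStep j.castSucc (lowBlock j m) (joinHalves A B) = joinHalves (sortStep j m A) B := by
  have h : LexLT (leftBlock j.castSucc (lowBlock j m) (joinHalves A B))
      (rightBlock j.castSucc (lowBlock j m) (joinHalves A B)) ↔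
      LexLT (leftBlock j m A) (rightBlock j m A) := by
    rw [leftBlock_lowBlock, rightBlock_lowBlock]
  unfold sortStep
  by_cases hc : LexLT (leftBlock j m A) (rightBlock j m A)
  · rw [if_pos (h.2 hc), if_pos hc, permute_lowBlock]
  · rw [if_neg (mt h.1 hc), if_neg hc]

theorem sortStep_highBlock {n : ℕ} (j : Fin n) (m : Fin (2 ^ (n - 1 - j.1))) (A B : Pattern n) :
    sortStep j.castSucc (highBlock j m) (joinHalves A B) = joinHalves A (sortStep j m B) := by
  have h : LexLT (leftBlock j.castSucc (highBlock j m) (joinHalves A B))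
      (rightBlock j.castSucc (highBlock j m) (joinHalves A B)) ↔
      LexLT (leftBlock j m B) (rightBlock j m B) := by
    rw [leftBlock_highBlock, rightBlock_highBlock]
  unfold sortStep
  by_cases hc : LexLT (leftBlock j m B) (rightBlock j m B)
  · rw [if_pos (h.2 hc), if_pos hc, permute_highBlock]
  · rw [if_neg (mt h.1 hc), if_neg hc]

/-! ### The algorithm level by level, and its recursion -/

theorem foldl_finRange_add {α : Type*} {a b c : ℕ} (h : a = b + c) (f : α → Fin a → α) (x : α) :
    (List.finRange a).foldl f x =
      (List.finRange c).foldl (fun y m => f y (Fin.cast h.symm (Fin.natAdd b m)))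
        ((List.finRange b).foldl (fun y m => f y (Fin.cast h.symm (Fin.castAdd c m))) x) := by
  subst h
  have : List.finRange (b + c) =
      (List.finRange b).map (Fin.castAdd c) ++ (List.finRange c).map (Fin.natAdd b) := by
    simp only [← List.ofFn_id, List.map_ofFn]
    rw [List.ofFn_add]
    rfl
  rw [this, List.foldl_append, List.foldl_map, List.foldl_map]
  rfl

/-- All steps of the algorithm for one block length `2 ^ j`. -/
def sortLevel {n : ℕ} (j : Fin n) (P : Pattern n) : Pattern n :=
  (List.finRange (2 ^ (n - 1 - j.1))).foldl (fun R m => sortStep j m R) P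

/-- Below the top level every block pair lies inside one half, so the steps treat first the left
half, then the right one, without interaction. -/
theorem sortLevel_castSucc {n : ℕ} (j : Fin n) (A B : Pattern n) :
    sortLevel j.castSucc (joinHalves A B) = joinHalves (sortLevel j A) (sortLevel j B) := by
  unfold sortLevel
  rw [foldl_finRange_add (two_pow_blocks j)]
  have hlow : ∀ (l : List (Fin (2 ^ (n - 1 - j.1)))) (A B : Pattern n),
      l.foldl (fun y m => sortStep j.castSucc (lowBlock j m) y) (joinHalves A B) =
        joinHalves (l.foldl (fun R m => sortStep j m R) A) B := by
    intro l
    induction l with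
    | nil => intro A B; rfl
    | cons m l ih => intro A B; simp only [List.foldl_cons, sortStep_lowBlock, ih]
  have hhigh : ∀ (l : List (Fin (2 ^ (n - 1 - j.1)))) (A B : Pattern n),
      l.foldl (fun y m => sortStep j.castSucc (highBlock j m) y) (joinHalves A B) =
        joinHalves A (l.foldl (fun R m => sortStep j m R) B) := by
    intro l
    induction l with
    | nil => intro A B; rfl
    | cons m l ih => intro A B; simp only [List.foldl_cons, sortStep_highBlock, ih]
  exact (congrArg (fun z => List.foldl (fun y m => sortStep j.castSucc (highBlock j m) y) z
    (List.finRange (2 ^ (n - 1 - j.1)))) (hlow _ A B)).trans (hhigh _ _ B)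

theorem two_pow_last (n : ℕ) : 2 ^ (n + 1 - 1 - (Fin.last n).1) = 1 := by simp

/-- The only block number at the top level. -/
def topBlock (n : ℕ) : Fin (2 ^ (n + 1 - 1 - (Fin.last n).1)) := ⟨0, by simp⟩

theorem eq_topBlock {n : ℕ} (m : Fin (2 ^ (n + 1 - 1 - (Fin.last n).1))) : m = topBlock n := by
  apply Fin.ext
  have := m.2
  have h := two_pow_last n
  simp only [topBlock]
  omega

theorem permute_topBlock {n : ℕ} (A B : Pattern n) :
    permute (elemPerm (Fin.last n) (topBlock n)) (joinHalves A B) = joinHalves B A := by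
  have h2 : 2 ^ (n + 1) = 2 ^ n + 2 ^ n := by ring
  have h0 : (topBlock n).1 = 0 := rfl
  refine eq_joinHalves (fun i => ?_) (fun i => ?_)
  · rw [permute, ← joinHalves_highPos A B]
    congr 1
    apply Fin.ext
    have := i.2
    rw [val_elemPerm]
    simp only [lowPos, highPos, Fin.val_last, h0]
    split_ifs <;> omega
  · rw [permute, ← joinHalves_lowPos A B]
    congr 1
    apply Fin.ext
    have := i.2
    rw [val_elemPerm]
    simp only [lowPos, highPos, Fin.val_last, h0]
    split_ifs <;> omega

theorem leftBlock_topBlock {n : ℕ} (A B : Pattern n) :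
    leftBlock (Fin.last n) (topBlock n) (joinHalves A B) = A := by
  funext r
  rw [leftBlock, ← joinHalves_lowPos A B]
  congr 1
  apply Fin.ext
  simp [topBlock, lowPos]

theorem rightBlock_topBlock {n : ℕ} (A B : Pattern n) :
    rightBlock (Fin.last n) (topBlock n) (joinHalves A B) = B := by
  funext r
  rw [rightBlock, ← joinHalves_highPos A B]
  congr 1
  apply Fin.ext
  simp [topBlock, highPos]

/-- Two patterns are put side by side in lexicographically nonincreasing order. -/
def joinSorted {n : ℕ} (A B : Pattern n) : Pattern (n + 1) :=
  if LexLT A B then joinHalves B A else joinHalves A B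

/-- The lexicographic order is total, so the only ambiguous case is `A = B`, where the order does
not matter. This is what absorbs a swap at the top level. -/
theorem joinSorted_comm {n : ℕ} (A B : Pattern n) : joinSorted A B = joinSorted B A := by
  unfold joinSorted
  rcases lt_trichotomy (toLex A) (toLex B) with h | h | h
  · rw [if_pos (show LexLT A B from h), if_neg (show ¬ LexLT B A from h.not_gt)]
  · rw [toLex_inj.1 h]
  · rw [if_pos (show LexLT B A from h), if_neg (show ¬ LexLT A B from h.not_gt)]

theorem sortLevel_last {n : ℕ} (A B : Pattern n) :
    sortLevel (Fin.last n) (joinHalves A B) = joinSorted A B := by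
  have h1 : List.finRange (2 ^ (n + 1 - 1 - (Fin.last n).1)) = [topBlock n] := by
    have hl : (List.finRange (2 ^ (n + 1 - 1 - (Fin.last n).1))).length = 1 := by simp
    obtain ⟨m, hm⟩ := List.length_eq_one_iff.1 hl
    rw [hm, eq_topBlock m]
  have h2 : LexLT (leftBlock (Fin.last n) (topBlock n) (joinHalves A B))
      (rightBlock (Fin.last n) (topBlock n) (joinHalves A B)) ↔ LexLT A B := by
    rw [leftBlock_topBlock, rightBlock_topBlock]
  rw [sortLevel, h1, List.foldl_cons, List.foldl_nil, sortStep, joinSorted]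
  by_cases hc : LexLT A B
  · rw [if_pos (h2.2 hc), if_pos hc, permute_topBlock]
  · rw [if_neg (mt h2.1 hc), if_neg hc]

theorem sortPattern_zero (P : Pattern 0) : sortPattern P = P := rfl

theorem sortPattern_joinHalves {n : ℕ} (A B : Pattern n) :
    sortPattern (joinHalves A B) = joinSorted (sortPattern A) (sortPattern B) := by
  have h : ∀ (l : List (Fin n)) (A B : Pattern n),
      (l.map Fin.castSucc).foldl (fun Q j => sortLevel j Q) (joinHalves A B) =
        joinHalves (l.foldl (fun Q j => sortLevel j Q) A)
          (l.foldl (fun Q j => sortLevel j Q) B) := by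
    intro l
    induction l with
    | nil => intro A B; rfl
    | cons j l ih => intro A B; simp only [List.map_cons, List.foldl_cons, sortLevel_castSucc, ih]
  change (List.finRange (n + 1)).foldl (fun Q j => sortLevel j Q) (joinHalves A B) = _
  rw [List.finRange_succ_last, List.foldl_append, h, List.foldl_cons, List.foldl_nil,
    sortLevel_last]
  rfl

/-- Either the swap exchanges the two halves, and `joinSorted` is commutative, or it acts inside one
half and the induction hypothesis applies. -/
theorem sortPattern_permute_elemPerm {n : ℕ} (j : Fin n) (m : Fin (2 ^ (n - 1 - j.1)))
    (P : Pattern n) : sortPattern (permute (elemPerm j m) P) = sortPattern P := by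
  induction n with
  | zero => exact j.elim0
  | succ n ih =>
    rw [← joinHalves_comp P]
    induction j using Fin.lastCases with
    | last =>
      rw [eq_topBlock m, permute_topBlock, sortPattern_joinHalves, sortPattern_joinHalves,
        joinSorted_comm]
    | cast j =>
      rcases lowBlock_or_highBlock j m with ⟨m, rfl⟩ | ⟨m, rfl⟩
      · rw [permute_lowBlock, sortPattern_joinHalves, sortPattern_joinHalves, ih]
      · rw [permute_highBlock, sortPattern_joinHalves, sortPattern_joinHalves, ih]

/-! ### Bit reversal -/

/-- The position `2 * i`. -/
def evenPos {n : ℕ} (i : Fin (2 ^ n)) : Fin (2 ^ (n + 1)) :=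
  ⟨2 * i.1, by have := i.2; have := pow_succ 2 n; omega⟩

/-- The position `2 * i + 1`. -/
def oddPos {n : ℕ} (i : Fin (2 ^ n)) : Fin (2 ^ (n + 1)) :=
  ⟨2 * i.1 + 1, by have := i.2; have := pow_succ 2 n; omega⟩

theorem bitReversal_finFunctionFinEquiv {n : ℕ} (f : Fin n → Fin 2) :
    bitReversal n (finFunctionFinEquiv f) = finFunctionFinEquiv (fun k => f k.rev) := by
  simp only [bitReversal, Equiv.trans_apply, Equiv.symm_apply_apply]
  rfl

theorem bitReversal_bitReversal {n : ℕ} (i : Fin (2 ^ n)) :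
    bitReversal n (bitReversal n i) = i := by
  obtain ⟨f, rfl⟩ := finFunctionFinEquiv.surjective i
  simp [bitReversal_finFunctionFinEquiv]

theorem permute_bitReversal_permute {n : ℕ} (P : Pattern n) :
    permute (bitReversal n) (permute (bitReversal n) P) = P := by
  funext i
  simp [permute, bitReversal_bitReversal]

theorem finFunctionFinEquiv_snoc {n : ℕ} (f : Fin n → Fin 2) (a : Fin 2) :
    (finFunctionFinEquiv (Fin.snoc f a : Fin (n + 1) → Fin 2)).1 =
      (finFunctionFinEquiv f).1 + a * 2 ^ n := by
  simp [Fin.sum_univ_castSucc]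

theorem finFunctionFinEquiv_cons {n : ℕ} (f : Fin n → Fin 2) (a : Fin 2) :
    (finFunctionFinEquiv (Fin.cons a f : Fin (n + 1) → Fin 2)).1 =
      2 * (finFunctionFinEquiv f).1 + a := by
  simp only [finFunctionFinEquiv_apply, Fin.sum_univ_succ, Fin.cons_zero, Fin.cons_succ,
    Fin.val_zero, pow_zero, mul_one, Fin.val_succ, Finset.mul_sum]
  rw [add_comm]
  congr 1
  exact Finset.sum_congr rfl fun i _ => by ring

theorem bitReversal_snoc {n : ℕ} (f : Fin n → Fin 2) (a : Fin 2) :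
    bitReversal (n + 1) (finFunctionFinEquiv (Fin.snoc f a : Fin (n + 1) → Fin 2)) =
      finFunctionFinEquiv (Fin.cons a (fun k => f k.rev) : Fin (n + 1) → Fin 2) := by
  rw [bitReversal_finFunctionFinEquiv]
  congr 1
  funext k
  induction k using Fin.cases with
  | zero => simp
  | succ k => simp [Fin.rev_succ]

theorem bitReversal_lowPos {n : ℕ} (i : Fin (2 ^ n)) :
    bitReversal (n + 1) (lowPos i) = evenPos (bitReversal n i) := by
  obtain ⟨f, rfl⟩ := finFunctionFinEquiv.surjective i
  have h1 : lowPos (finFunctionFinEquiv f) =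
      finFunctionFinEquiv (Fin.snoc f 0 : Fin (n + 1) → Fin 2) := by
    apply Fin.ext
    rw [finFunctionFinEquiv_snoc]
    simp [lowPos]
  rw [h1, bitReversal_snoc, bitReversal_finFunctionFinEquiv]
  apply Fin.ext
  rw [finFunctionFinEquiv_cons]
  simp [evenPos]

theorem bitReversal_highPos {n : ℕ} (i : Fin (2 ^ n)) :
    bitReversal (n + 1) (highPos i) = oddPos (bitReversal n i) := by
  obtain ⟨f, rfl⟩ := finFunctionFinEquiv.surjective i
  have h1 : highPos (finFunctionFinEquiv f) =
      finFunctionFinEquiv (Fin.snoc f 1 : Fin (n + 1) → Fin 2) := by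
    apply Fin.ext
    rw [finFunctionFinEquiv_snoc]
    simp [highPos, add_comm]
  rw [h1, bitReversal_snoc, bitReversal_finFunctionFinEquiv]
  apply Fin.ext
  rw [finFunctionFinEquiv_cons]
  simp [oddPos]

/-- The entries of a vector at the even positions. -/
def evenPart {α : Type*} {n : ℕ} (u : Fin (2 ^ (n + 1)) → α) : Fin (2 ^ n) → α :=
  fun i => u (evenPos i)

/-- The entries of a vector at the odd positions. -/
def oddPart {α : Type*} {n : ℕ} (u : Fin (2 ^ (n + 1)) → α) : Fin (2 ^ n) → α :=
  fun i => u (oddPos i)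

/-- The bridge between the two recursions: the channel side splits by the lowest digit, the sorting
side by the highest. -/
theorem permute_bitReversal_succ {n : ℕ} (P : Pattern (n + 1)) :
    permute (bitReversal (n + 1)) P = joinHalves (permute (bitReversal n) (evenPart P))
      (permute (bitReversal n) (oddPart P)) := by
  rw [← joinHalves_comp (permute (bitReversal (n + 1)) P), joinHalves_inj]
  refine ⟨funext fun i => ?_, funext fun i => ?_⟩
  · simp only [permute, bitReversal_lowPos, evenPart]
  · simp only [permute, bitReversal_highPos, oddPart]

/-! ### Primitive patterns -/

theorem isPrimitive_iff {n : ℕ} (P : Pattern n) :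
    IsPrimitive P ↔ sortPattern (permute (bitReversal n) P) = permute (bitReversal n) P := by
  unfold IsPrimitive Phi
  constructor
  · intro h
    have h' := congrArg (permute (bitReversal n)) h
    rwa [permute_bitReversal_permute] at h'
  · intro h
    rw [h, permute_bitReversal_permute]

theorem isPrimitive_succ {n : ℕ} {P : Pattern (n + 1)} (he : IsPrimitive (evenPart P))
    (ho : IsPrimitive (oddPart P)) (hle : ∀ i, oddPart P i ≤ evenPart P i) : IsPrimitive P := by
  rw [isPrimitive_iff] at *
  rw [permute_bitReversal_succ, sortPattern_joinHalves, he, ho, joinSorted, if_neg]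
  exact not_lexLT_of_le fun i => hle _

/-- The two inner bit reversals cancel, leaving elementary permutations in front of the sort, which
ignores them. -/
theorem Equivalent.phi_eq {n : ℕ} {P P' : Pattern n} (h : Equivalent P P') : Phi P' = Phi P := by
  obtain ⟨L, rfl⟩ := h
  unfold Phi
  rw [permute_bitReversal_permute]
  congr 1
  generalize permute (bitReversal n) P = A
  induction L generalizing A with
  | nil => rfl
  | cons s L ih => rw [List.foldl_cons, ih, sortPattern_permute_elemPerm]

/-! ### Even and odd positions of the encoder -/

/-- The Kronecker definition peels off the highest digit; this form, symmetric in the digits, also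
lets the lowest one be peeled off, as the decoding order requires. -/
theorem genMatrix_apply {n : ℕ} (i j : Fin (2 ^ n)) :
    genMatrix n i j = ∏ k ∈ Finset.range n,
      kernelMatrix (Fin.ofNat 2 (i.1 / 2 ^ k)) (Fin.ofNat 2 (j.1 / 2 ^ k)) := by
  induction n with
  | zero =>
    rw [show i = j from Subsingleton.elim (α := Fin 1) i j]
    exact Matrix.one_apply_eq j
  | succ n ih =>
    have hdig : ∀ (a k : ℕ), k < n → Fin.ofNat 2 (a % 2 ^ n / 2 ^ k) = Fin.ofNat 2 (a / 2 ^ k) := by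
      intro a k hk
      apply Fin.ext
      -- Reduction modulo `2 ^ n` keeps digit `k < n`: a factor `2` remains after dividing by `2 ^
      -- k`.
      have h1 : 2 ^ n = 2 ^ k * (2 * 2 ^ (n - k - 1)) := by
        rw [← pow_succ', ← pow_add]
        congr 1
        omega
      simp only [Fin.val_ofNat]
      rw [h1, Nat.mod_mul_right_div_self, Nat.mod_mul_right_mod]
    have htop : ∀ a : Fin (2 ^ (n + 1)),
        (finProdFinEquiv.symm (finCongr (pow_succ' 2 n) a)).1 = Fin.ofNat 2 (a.1 / 2 ^ n) ∧
        ((finProdFinEquiv.symm (finCongr (pow_succ' 2 n) a)).2 : ℕ) = a.1 % 2 ^ n := by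
      intro a
      refine ⟨Fin.ext ?_, rfl⟩
      have ha := a.2
      have h : a.1 / 2 ^ n < 2 := by
        rw [Nat.div_lt_iff_lt_mul (by positivity), ← pow_succ']
        exact ha
      simp only [Fin.val_ofNat, Nat.mod_eq_of_lt h]
      rfl
    change kernelMatrix (finProdFinEquiv.symm (finCongr (pow_succ' 2 n) i)).1
        (finProdFinEquiv.symm (finCongr (pow_succ' 2 n) j)).1 *
      genMatrix n (finProdFinEquiv.symm (finCongr (pow_succ' 2 n) i)).2
        (finProdFinEquiv.symm (finCongr (pow_succ' 2 n) j)).2 = _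
    rw [ih, (htop i).1, (htop j).1, (htop i).2, (htop j).2, Finset.prod_range_succ, mul_comm]
    congr 1
    refine Finset.prod_congr rfl fun k hk => ?_
    rw [hdig _ k (Finset.mem_range.1 hk), hdig _ k (Finset.mem_range.1 hk)]

/-- Positions `2 * i + a` as pairs `(i, a)`. -/
def parityEquiv (n : ℕ) : Fin (2 ^ n) × Fin 2 ≃ Fin (2 ^ (n + 1)) :=
  finProdFinEquiv.trans (finCongr (pow_succ 2 n).symm)

theorem val_parityEquiv {n : ℕ} (i : Fin (2 ^ n)) (a : Fin 2) :
    (parityEquiv n (i, a)).1 = a.1 + 2 * i.1 := rfl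

theorem parityEquiv_zero {n : ℕ} (i : Fin (2 ^ n)) : parityEquiv n (i, 0) = evenPos i :=
  Fin.ext (by simp [val_parityEquiv, evenPos])

theorem parityEquiv_one {n : ℕ} (i : Fin (2 ^ n)) : parityEquiv n (i, 1) = oddPos i :=
  Fin.ext (by simp [val_parityEquiv, oddPos, add_comm])

theorem prod_parity {M : Type*} [CommMonoid M] {n : ℕ} (f : Fin (2 ^ (n + 1)) → M) :
    ∏ i, f i = (∏ i, f (evenPos i)) * ∏ i, f (oddPos i) := by
  rw [← (parityEquiv n).prod_comp, Fintype.prod_prod_type, ← Finset.prod_mul_distrib]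
  simp [Fin.prod_univ_two, parityEquiv_zero, parityEquiv_one]

theorem sum_parity {M : Type*} [AddCommMonoid M] {n : ℕ} (f : Fin (2 ^ (n + 1)) → M) :
    ∑ i, f i = (∑ i, f (evenPos i)) + ∑ i, f (oddPos i) := by
  rw [← (parityEquiv n).sum_comp, Fintype.sum_prod_type, ← Finset.sum_add_distrib]
  simp [Fin.sum_univ_two, parityEquiv_zero, parityEquiv_one]

theorem forall_parity {n : ℕ} {p : Fin (2 ^ (n + 1)) → Prop} :
    (∀ i, p i) ↔ (∀ i, p (evenPos i)) ∧ ∀ i, p (oddPos i) := by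
  refine ⟨fun h => ⟨fun i => h _, fun i => h _⟩, fun ⟨h0, h1⟩ i => ?_⟩
  obtain ⟨⟨i, a⟩, rfl⟩ := (parityEquiv n).surjective i
  fin_cases a
  · exact (parityEquiv_zero i) ▸ h0 i
  · exact (parityEquiv_one i) ▸ h1 i

theorem genMatrix_parity {n : ℕ} (i j : Fin (2 ^ n)) (a b : Fin 2) :
    genMatrix (n + 1) (parityEquiv n (i, a)) (parityEquiv n (j, b)) =
      kernelMatrix a b * genMatrix n i j := by
  rw [genMatrix_apply, genMatrix_apply, Finset.prod_range_succ', mul_comm]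
  have h0 : ∀ (i : Fin (2 ^ n)) (a : Fin 2),
      Fin.ofNat 2 ((parityEquiv n (i, a)).1 / 2 ^ 0) = a := by
    intro i a
    apply Fin.ext
    have := a.2
    simp only [val_parityEquiv, Fin.val_ofNat]
    omega
  have h1 : ∀ (i : Fin (2 ^ n)) (a : Fin 2) (k : ℕ),
      (parityEquiv n (i, a)).1 / 2 ^ (k + 1) = i.1 / 2 ^ k := by
    intro i a k
    rw [pow_succ' 2 k, ← Nat.div_div_eq_div_mul]
    congr 1
    have := a.2
    rw [val_parityEquiv]
    omega
  simp only [h0, h1]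

theorem vecMul_genMatrix_even {n : ℕ} (u : Fin (2 ^ (n + 1)) → ZMod 2) (j : Fin (2 ^ n)) :
    (u ᵥ* genMatrix (n + 1)) (evenPos j) =
      ((fun i => evenPart u i + oddPart u i) ᵥ* genMatrix n) j := by
  simp only [Matrix.vecMul, dotProduct, sum_parity, ← Finset.sum_add_distrib, ← parityEquiv_zero,
    ← parityEquiv_one, genMatrix_parity, evenPart, oddPart]
  simp [kernelMatrix, add_mul]

theorem vecMul_genMatrix_odd {n : ℕ} (u : Fin (2 ^ (n + 1)) → ZMod 2) (j : Fin (2 ^ n)) :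
    (u ᵥ* genMatrix (n + 1)) (oddPos j) = (oddPart u ᵥ* genMatrix n) j := by
  simp only [Matrix.vecMul, dotProduct, sum_parity, ← Finset.sum_add_distrib, ← parityEquiv_zero,
    ← parityEquiv_one, genMatrix_parity, oddPart]
  simp [kernelMatrix]

/-- A vector is determined by the sum of its two parity parts and by its odd part. -/
noncomputable def butterflyEquiv (n : ℕ) : (Fin (2 ^ (n + 1)) → ZMod 2) ≃
    (Fin (2 ^ n) → ZMod 2) × (Fin (2 ^ n) → ZMod 2) :=
  Equiv.ofBijective (fun u => (fun i => evenPart u i + oddPart u i, oddPart u)) <| by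
    constructor
    · intro u v h
      rw [Prod.mk.injEq] at h
      have ho : ∀ i, u (oddPos i) = v (oddPos i) := fun i => congrFun h.2 i
      refine funext (forall_parity.2 ⟨fun i => ?_, ho⟩)
      have := congrFun h.1 i
      simp only [evenPart, oddPart, ho i] at this
      exact add_right_cancel this
    · rintro ⟨v, w⟩
      refine ⟨fun k => if ((parityEquiv n).symm k).2 = 0 then
        v ((parityEquiv n).symm k).1 - w ((parityEquiv n).symm k).1
        else w ((parityEquiv n).symm k).1, ?_⟩
      ext i <;> simp [evenPart, oddPart, ← parityEquiv_zero, ← parityEquiv_one]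

/-! ### Sums over the data vectors with a given prefix -/

/-- The sum of `∏ j, f j (x j)`, `x = u · G_N`, over the data vectors `u` that agree with `c` up to
position `i`. -/
noncomputable def prefixSum {n : ℕ} (f : Fin (2 ^ n) → ZMod 2 → ℝ) (i : Fin (2 ^ n))
    (c : Fin (2 ^ n) → ZMod 2) : ℝ :=
  ∑ u : Fin (2 ^ n) → ZMod 2,
    if ∀ k ≤ i, u k = c k then ∏ j, f j ((u ᵥ* genMatrix n) j) else 0

theorem prefixSum_pos {n : ℕ} {f : Fin (2 ^ n) → ZMod 2 → ℝ} (hf : ∀ j x, 0 < f j x)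
    (i : Fin (2 ^ n)) (c : Fin (2 ^ n) → ZMod 2) : 0 < prefixSum f i c := by
  unfold prefixSum
  refine Finset.sum_pos' (fun u _ => ?_) ⟨c, Finset.mem_univ _, ?_⟩
  · split_ifs
    · exact Finset.prod_nonneg fun j _ => (hf _ _).le
    · exact le_rfl
  · simp only [implies_true, if_true]
    exact Finset.prod_pos fun j _ => hf _ _

/-- A prefix ending at an odd position contains whole pairs, so under `butterflyEquiv` both the
prefix condition and the product of factors split. -/
theorem prefixSum_oddPos {n : ℕ} (f : Fin (2 ^ (n + 1)) → ZMod 2 → ℝ) (i : Fin (2 ^ n))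
    (c : Fin (2 ^ (n + 1)) → ZMod 2) :
    prefixSum f (oddPos i) c =
      prefixSum (evenPart f) i (fun k => evenPart c k + oddPart c k) *
        prefixSum (oddPart f) i (oddPart c) := by
  unfold prefixSum
  rw [Finset.sum_mul_sum, ← Finset.sum_product', Finset.univ_product_univ]
  refine Fintype.sum_equiv (butterflyEquiv n) _ _ fun u => ?_
  have hp : (∀ k ≤ oddPos i, u k = c k) ↔
      (∀ k ≤ i, evenPart u k + oddPart u k = evenPart c k + oddPart c k) ∧
        ∀ k ≤ i, oddPart u k = oddPart c k := by
    rw [forall_parity]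
    have he : ∀ k : Fin (2 ^ n), evenPos k ≤ oddPos i ↔ k ≤ i := by
      intro k
      simp only [Fin.le_def, evenPos, oddPos]
      omega
    have ho : ∀ k : Fin (2 ^ n), oddPos k ≤ oddPos i ↔ k ≤ i := by
      intro k
      simp only [Fin.le_def, oddPos]
      omega
    simp only [he, ho]
    -- Once the odd entries agree, they cancel from the condition on the sums.
    refine and_congr_left fun h => forall₂_congr fun k hk => ?_
    have := h k hk
    simp only [evenPart, oddPart] at *
    rw [this, add_left_inj]
  change _ = (if ∀ k ≤ i, evenPart u k + oddPart u k = evenPart c k + oddPart c k then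
      ∏ j, evenPart f j (((fun k => evenPart u k + oddPart u k) ᵥ* genMatrix n) j) else 0) *
    (if ∀ k ≤ i, oddPart u k = oddPart c k then ∏ j, oddPart f j ((oddPart u ᵥ* genMatrix n) j)
      else 0)
  rw [ite_zero_mul_ite_zero]
  refine if_congr hp ?_ rfl
  rw [prod_parity]
  simp only [vecMul_genMatrix_even, vecMul_genMatrix_odd]
  rfl

theorem prefixSum_evenPos {n : ℕ} (f : Fin (2 ^ (n + 1)) → ZMod 2 → ℝ) (i : Fin (2 ^ n))
    (c : Fin (2 ^ (n + 1)) → ZMod 2) :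
    prefixSum f (evenPos i) c =
      ∑ y : ZMod 2, prefixSum f (oddPos i) (Function.update c (oddPos i) y) := by
  unfold prefixSum
  rw [Finset.sum_comm]
  refine Finset.sum_congr rfl fun u _ => ?_
  -- Each `u` with the prefix up to `2 * i` is counted for exactly one `y`, its own next bit.
  have h : ∀ y, (∀ k ≤ oddPos i, u k = Function.update c (oddPos i) y k) ↔
      y = u (oddPos i) ∧ ∀ k ≤ evenPos i, u k = c k := by
    intro y
    constructor
    · intro h
      refine ⟨by simpa using (h _ le_rfl).symm, fun k hk => ?_⟩
      have hlt : k < oddPos i := by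
        simp only [Fin.lt_def, Fin.le_def, evenPos, oddPos] at *
        omega
      simpa [hlt.ne] using h k hlt.le
    · rintro ⟨rfl, h⟩ k hk
      rcases hk.eq_or_lt with rfl | hlt
      · simp
      · rw [Function.update_of_ne hlt.ne]
        apply h
        simp only [Fin.lt_def, Fin.le_def, evenPos, oddPos] at *
        omega
  simp only [h, ite_and]
  simp

/-! ### Positions without information -/

/-- The bit at position `i` has no influence on the prefix sums, when each factor `f j` is taken from
the class `F (P j)`. -/
def NoInfluence (F : Bool → Set (ZMod 2 → ℝ)) {n : ℕ} (P : Pattern n) (i : Fin (2 ^ n)) : Prop :=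
  ∀ f : Fin (2 ^ n) → ZMod 2 → ℝ, (∀ j, f j ∈ F (P j)) → ∀ c : Fin (2 ^ n) → ZMod 2,
    prefixSum f i (Function.update c i 0) = prefixSum f i (Function.update c i 1)

/-- Merges two vectors into one with given parity parts. -/
def interleave {α : Type*} {n : ℕ} (a b : Fin (2 ^ n) → α) (k : Fin (2 ^ (n + 1))) : α :=
  if ((parityEquiv n).symm k).2 = 0 then a ((parityEquiv n).symm k).1
  else b ((parityEquiv n).symm k).1

theorem interleave_evenPos {α : Type*} {n : ℕ} (a b : Fin (2 ^ n) → α) (i : Fin (2 ^ n)) :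
    interleave a b (evenPos i) = a i := by
  simp [interleave, ← parityEquiv_zero]

theorem interleave_oddPos {α : Type*} {n : ℕ} (a b : Fin (2 ^ n) → α) (i : Fin (2 ^ n)) :
    interleave a b (oddPos i) = b i := by
  simp [interleave, ← parityEquiv_one]

@[simp] theorem evenPart_interleave {α : Type*} {n : ℕ} (a b : Fin (2 ^ n) → α) :
    evenPart (interleave a b) = a :=
  funext fun i => interleave_evenPos a b i

@[simp] theorem oddPart_interleave {α : Type*} {n : ℕ} (a b : Fin (2 ^ n) → α) :
    oddPart (interleave a b) = b :=
  funext fun i => interleave_oddPos a b i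

theorem evenPos_ne_oddPos {n : ℕ} (i k : Fin (2 ^ n)) : evenPos i ≠ oddPos k := by
  intro h
  have := congrArg Fin.val h
  simp only [evenPos, oddPos] at this
  omega

theorem evenPos_injective {n : ℕ} : Function.Injective (evenPos (n := n)) := by
  intro i k h
  have := congrArg Fin.val h
  simp only [evenPos] at this
  exact Fin.ext (by omega)

theorem oddPos_injective {n : ℕ} : Function.Injective (oddPos (n := n)) := by
  intro i k h
  have := congrArg Fin.val h
  simp only [oddPos] at this
  exact Fin.ext (by omega)

theorem prefixSum_oddPos_update {n : ℕ} (f : Fin (2 ^ (n + 1)) → ZMod 2 → ℝ) (i : Fin (2 ^ n))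
    (c : Fin (2 ^ (n + 1)) → ZMod 2) (x y : ZMod 2) :
    prefixSum f (oddPos i) (Function.update (Function.update c (evenPos i) x) (oddPos i) y) =
      prefixSum (evenPart f) i
          (Function.update (fun k => evenPart c k + oddPart c k) i (x + y)) *
        prefixSum (oddPart f) i (Function.update (oddPart c) i y) := by
  have he : evenPart (Function.update (Function.update c (evenPos i) x) (oddPos i) y) =
      Function.update (evenPart c) i x := by
    funext k
    simp only [evenPart, Function.update_of_ne (evenPos_ne_oddPos k i), Function.update_apply,
      evenPos_injective.eq_iff]
  have ho : oddPart (Function.update (Function.update c (evenPos i) x) (oddPos i) y) =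
      Function.update (oddPart c) i y := by
    funext k
    simp only [oddPart, Function.update_apply, oddPos_injective.eq_iff,
      (evenPos_ne_oddPos i k).symm, if_false]
  rw [prefixSum_oddPos, he, ho]
  congr 2
  funext k
  by_cases hk : k = i
  · subst hk; simp
  · simp [hk]

theorem zmod_two_one_add_one : (1 : ZMod 2) + 1 = 0 := rfl

theorem noInfluence_evenPos {F : Bool → Set (ZMod 2 → ℝ)} {n : ℕ} {P : Pattern (n + 1)}
    {i : Fin (2 ^ n)} :
    NoInfluence F P (evenPos i) ↔ NoInfluence F (evenPart P) i ∨ NoInfluence F (oddPart P) i := by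
  have key : ∀ (f : Fin (2 ^ (n + 1)) → ZMod 2 → ℝ) (c : Fin (2 ^ (n + 1)) → ZMod 2),
      prefixSum f (evenPos i) (Function.update c (evenPos i) 0) -
        prefixSum f (evenPos i) (Function.update c (evenPos i) 1) =
      (prefixSum (evenPart f) i (Function.update (fun k => evenPart c k + oddPart c k) i 0) -
        prefixSum (evenPart f) i (Function.update (fun k => evenPart c k + oddPart c k) i 1)) *
      (prefixSum (oddPart f) i (Function.update (oddPart c) i 0) -
        prefixSum (oddPart f) i (Function.update (oddPart c) i 1)) := by
    intro f c
    have hu : (Finset.univ : Finset (ZMod 2)) = {0, 1} := rfl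
    rw [prefixSum_evenPos, prefixSum_evenPos, hu, Finset.sum_pair zero_ne_one,
      Finset.sum_pair zero_ne_one]
    simp only [prefixSum_oddPos_update, add_zero, zero_add, zmod_two_one_add_one]
    ring
  constructor
  · intro h
    by_contra! hc
    simp only [NoInfluence, not_forall] at hc
    obtain ⟨⟨f, hf, c, hfc⟩, ⟨g, hg, d, hgd⟩⟩ := hc
    -- The even entries `c - d` make the sum of the parity parts equal to `c`, so the two nonzero
    -- differences occur as factors together.
    have h1 := key (interleave f g) (interleave (fun k => c k - d k) d)
    rw [h (interleave f g) (forall_parity.2 ⟨fun k => ?_, fun k => ?_⟩), sub_self] at h1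
    · simp only [evenPart_interleave, oddPart_interleave, sub_add_cancel] at h1
      rcases mul_eq_zero.1 h1.symm with h2 | h2
      · exact hfc (sub_eq_zero.1 h2)
      · exact hgd (sub_eq_zero.1 h2)
    · rw [interleave_evenPos]; exact hf k
    · rw [interleave_oddPos]; exact hg k
  · intro h f hf c
    rw [← sub_eq_zero, key, mul_eq_zero, sub_eq_zero, sub_eq_zero]
    rcases h with h | h
    · exact Or.inl (h _ (fun j => hf _) _)
    · exact Or.inr (h _ (fun j => hf _) _)

/-- For the forward direction one half gets the constant factors `1`, whose prefix sums are
positive. The two relations for `x = 0` and `x = 1` then combine to a difference for the other half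
times a positive number. -/
theorem noInfluence_oddPos {F : Bool → Set (ZMod 2 → ℝ)} (hF : ∀ p, (fun _ => 1) ∈ F p) {n : ℕ}
    {P : Pattern (n + 1)} {i : Fin (2 ^ n)} :
    NoInfluence F P (oddPos i) ↔ NoInfluence F (evenPart P) i ∧ NoInfluence F (oddPart P) i := by
  constructor
  · intro h
    have key : ∀ (f g : Fin (2 ^ n) → ZMod 2 → ℝ) (c d : Fin (2 ^ n) → ZMod 2),
        (∀ j, f j ∈ F (evenPart P j)) → (∀ j, g j ∈ F (oddPart P j)) → ∀ x : ZMod 2,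
        prefixSum f i (Function.update c i x) * prefixSum g i (Function.update d i 0) =
          prefixSum f i (Function.update c i (x + 1)) * prefixSum g i (Function.update d i 1) := by
      intro f g c d hf hg x
      have h1 := h (interleave f g) (forall_parity.2 ⟨fun k => ?_, fun k => ?_⟩)
        (Function.update (interleave (fun k => c k - d k) d) (evenPos i) x)
      · simpa only [prefixSum_oddPos_update, evenPart_interleave, oddPart_interleave,
          sub_add_cancel, add_zero] using h1
      · rw [interleave_evenPos]; exact hf k
      · rw [interleave_oddPos]; exact hg k
    constructor
    · intro f hf c
      have h0 := key f (fun _ _ => 1) c c hf (fun j => hF _) 0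
      have h1 := key f (fun _ _ => 1) c c hf (fun j => hF _) 1
      rw [zero_add] at h0
      rw [zmod_two_one_add_one] at h1
      have p0 := prefixSum_pos (f := fun _ _ => 1) (fun _ _ => one_pos) i (Function.update c i 0)
      have p1 := prefixSum_pos (f := fun _ _ => 1) (fun _ _ => one_pos) i (Function.update c i 1)
      have h2 : (prefixSum f i (Function.update c i 0) - prefixSum f i (Function.update c i 1)) *
          (prefixSum (fun _ _ => 1) i (Function.update c i 0) +
            prefixSum (fun _ _ => 1) i (Function.update c i 1)) = 0 := by
        linear_combination h0 - h1
      rcases mul_eq_zero.1 h2 with h3 | h3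
      · exact sub_eq_zero.1 h3
      · exact absurd h3 (add_pos p0 p1).ne'
    · intro g hg d
      have h0 := key (fun _ _ => 1) g d d (fun j => hF _) hg 0
      have h1 := key (fun _ _ => 1) g d d (fun j => hF _) hg 1
      rw [zero_add] at h0
      rw [zmod_two_one_add_one] at h1
      have p0 := prefixSum_pos (f := fun _ _ => 1) (fun _ _ => one_pos) i (Function.update d i 0)
      have p1 := prefixSum_pos (f := fun _ _ => 1) (fun _ _ => one_pos) i (Function.update d i 1)
      have h2 : (prefixSum (fun _ _ => 1) i (Function.update d i 0) +
            prefixSum (fun _ _ => 1) i (Function.update d i 1)) *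
          (prefixSum g i (Function.update d i 0) - prefixSum g i (Function.update d i 1)) = 0 := by
        linear_combination h0 + h1
      rcases mul_eq_zero.1 h2 with h3 | h3
      · exact absurd h3 (add_pos p0 p1).ne'
      · exact sub_eq_zero.1 h3
  · rintro ⟨he, ho⟩ f hf c
    -- A trivial update of `c` that brings the goal to the form of `prefixSum_oddPos_update`.
    obtain ⟨x, hc⟩ : ∃ x, c = Function.update c (evenPos i) x :=
      ⟨c (evenPos i), (Function.update_eq_self (evenPos i) c).symm⟩
    have h1 := he (evenPart f) (fun j => hf _) (fun k => evenPart c k + oddPart c k)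
    have h2 := ho (oddPart f) (fun j => hf _) (oddPart c)
    have h3 : ∀ x, prefixSum (evenPart f) i
        (Function.update (fun k => evenPart c k + oddPart c k) i x) =
        prefixSum (evenPart f) i
          (Function.update (fun k => evenPart c k + oddPart c k) i 0) := by
      intro x
      fin_cases x
      · rfl
      · exact h1.symm
    rw [hc, prefixSum_oddPos_update, prefixSum_oddPos_update, h2, h3, h3 (x + 1)]

theorem noInfluence_zero {F : Bool → Set (ZMod 2 → ℝ)} (h1 : ∀ f ∈ F true, f 0 = f 1)
    (h2 : ∃ f ∈ F false, f 0 ≠ f 1) {P : Pattern 0} {i : Fin (2 ^ 0)} :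
    NoInfluence F P i ↔ P i = true := by
  have hi : ∀ k : Fin (2 ^ 0), k = i := fun k => Subsingleton.elim (α := Fin 1) k i
  have key : ∀ (f : Fin (2 ^ 0) → ZMod 2 → ℝ) c, prefixSum f i c = f i (c i) := by
    intro f c
    unfold prefixSum
    rw [Finset.sum_eq_single c]
    · rw [if_pos fun _ _ => rfl]
      have : genMatrix 0 = 1 := rfl
      rw [this, Matrix.vecMul_one]
      exact Fin.prod_univ_one _ |>.trans (by rw [hi 0])
    · intro u _ hu
      rw [if_neg]
      intro h
      exact hu (funext fun k => h k (hi k).le)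
    · simp
  simp only [NoInfluence, key, Function.update_self]
  constructor
  · intro h
    by_contra hP
    rw [Bool.not_eq_true] at hP
    obtain ⟨f, hf, hne⟩ := h2
    exact hne (h (fun _ => f) (fun j => by rw [hi j, hP]; exact hf) 0)
  · intro hP f hf _
    exact h1 _ (hP ▸ hf i)

/-! ### Channels of capacity zero -/

section Channel

variable {Y : Type*} [MeasurableSpace Y]

/-- Both divergences vanish exactly when each law equals the mixture, hence the other law; the
divisor `log 2` is finite. -/
theorem symCapacity_eq_zero_iff (W : ZMod 2 → Measure Y) [∀ x, IsFiniteMeasure (W x)] :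
    symCapacity W = 0 ↔ W 0 = W 1 := by
  have hu : (Finset.univ : Finset (ZMod 2)) = {0, 1} := rfl
  have h2 : (2⁻¹ : ℝ≥0∞) ≠ 0 := by simp
  have hfin : IsFiniteMeasure ((2⁻¹ : ℝ≥0∞) • (W 0 + W 1)) :=
    Measure.smul_finite _ (by simp)
  unfold symCapacity
  rw [ENNReal.div_eq_zero_iff, hu, Finset.sum_pair zero_ne_one, add_eq_zero, mul_eq_zero,
    mul_eq_zero, InformationTheory.klDiv_eq_zero_iff, InformationTheory.klDiv_eq_zero_iff]
  simp only [h2, ENNReal.ofReal_ne_top, or_false, false_or]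
  refine ⟨fun h => h.1.trans h.2.symm, fun h => ?_⟩
  have : (2⁻¹ : ℝ≥0∞) • (W 1 + W 1) = W 1 := by
    rw [← two_smul ℝ≥0∞ (W 1), smul_smul, ENNReal.inv_mul_cancel two_ne_zero (by simp), one_smul]
  rw [h, this]
  exact ⟨rfl, rfl⟩

/-! ### The virtual channel on product events -/

instance isProbabilityMeasure_puncturedLaw (W : ZMod 2 → Measure Y)
    [∀ x, IsProbabilityMeasure (W x)] (p : Bool) (x : ZMod 2) :
    IsProbabilityMeasure (puncturedLaw W p x) := by
  unfold puncturedLaw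
  split_ifs
  · infer_instance
  · exact Measure.isProbabilityMeasure_map measurable_inl.aemeasurable

instance isProbabilityMeasure_receivedLaw (W : ZMod 2 → Measure Y)
    [∀ x, IsProbabilityMeasure (W x)] {n : ℕ} (P : Pattern n) (u : Fin (2 ^ n) → ZMod 2) :
    IsProbabilityMeasure (receivedLaw W P u) := by
  unfold receivedLaw
  infer_instance

instance isFiniteMeasure_virtualChannel (W : ZMod 2 → Measure Y)
    [∀ x, IsProbabilityMeasure (W x)] {n : ℕ} (P : Pattern n) (i : Fin (2 ^ n)) (b : ZMod 2) :
    IsFiniteMeasure (virtualChannel W P i b) := by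
  unfold virtualChannel
  refine Measure.smul_finite _ ?_
  rw [Ne, ENNReal.inv_eq_top]
  exact pow_ne_zero _ two_ne_zero

/-- The probabilities of an event at one received symbol, as functions of the code bit. -/
def eventClass (W : ZMod 2 → Measure Y) (p : Bool) : Set (ZMod 2 → ℝ) :=
  {f | ∃ A, MeasurableSet A ∧ f = fun x => (puncturedLaw W p x).real A}

theorem virtualChannel_pi_prod (W : ZMod 2 → Measure Y) [∀ x, IsProbabilityMeasure (W x)]
    {n : ℕ} (P : Pattern n) (i : Fin (2 ^ n)) (b : ZMod 2) (c : Fin (2 ^ n) → ZMod 2)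
    (A : Fin (2 ^ n) → Set (Y ⊕ Unit)) :
    (virtualChannel W P i b).real (Set.univ.pi A ×ˢ {fun j : {j // j < i} => c j}) =
      ((2 : ℝ) ^ (2 ^ n - 1))⁻¹ *
        prefixSum (fun j x => (puncturedLaw W (P j) x).real (A j)) i (Function.update c i b) := by
  have hterm : ∀ u : Fin (2 ^ n) → ZMod 2,
      ((receivedLaw W P u).prod (Measure.dirac fun j : {j // j < i} => u j)).real
        (Set.univ.pi A ×ˢ {fun j : {j // j < i} => c j}) =
      if ∀ k < i, u k = c k then
        ∏ j, (puncturedLaw W (P j) ((u ᵥ* genMatrix n) j)).real (A j) else 0 := by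
    intro u
    rw [measureReal_prod_prod, measureReal_def (receivedLaw W P u), receivedLaw, Measure.pi_pi,
      ENNReal.toReal_prod, measureReal_def,
      Measure.dirac_apply' _ (measurableSet_singleton _)]
    by_cases h : ∀ k < i, u k = c k
    · have : (fun j : {j // j < i} => u j) = fun j : {j // j < i} => c j :=
        funext fun j => h j.1 j.2
      rw [if_pos h, this]
      simp [measureReal_def]
    · rw [if_neg h, Set.indicator_of_notMem]
      · simp
      · intro hmem
        exact h fun k hk => congrFun hmem ⟨k, hk⟩
  rw [virtualChannel, measureReal_ennreal_smul_apply, measureReal_def,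
    Measure.finsetSum_apply, ENNReal.toReal_sum fun _ _ => measure_ne_top _ _]
  congr 1
  · simp
  · rw [prefixSum, Finset.sum_filter]
    refine Finset.sum_congr rfl fun u _ => ?_
    rw [← measureReal_def, hterm, ← ite_and]
    -- The input condition `u i = b` and the observed bits before `i` together say that `u` agrees
    -- with the updated `c` up to and including `i`.
    refine if_congr ?_ rfl rfl
    constructor
    · rintro ⟨hb, h⟩ k hk
      rcases hk.eq_or_lt with rfl | hlt
      · simpa using hb
      · rw [Function.update_of_ne hlt.ne, h k hlt]
    · intro h
      refine ⟨by simpa using h i le_rfl, fun k hk => ?_⟩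
      rw [h k hk.le, Function.update_of_ne hk.ne]

end Channel

/-- Each slice over a point of the countable factor is a finite measure, determined by the π-system
of boxes; countable additivity reassembles the slices. -/
theorem measure_ext_pi_prod_singleton {ι C : Type*} [Finite ι] {X : ι → Type*}
    [∀ i, MeasurableSpace (X i)] [Countable C] [MeasurableSpace C] [MeasurableSingletonClass C]
    {μ ν : Measure ((∀ i, X i) × C)} [IsFiniteMeasure μ] [IsFiniteMeasure ν]
    (h : ∀ (A : ∀ i, Set (X i)), (∀ i, MeasurableSet (A i)) → ∀ c,
      μ (Set.univ.pi A ×ˢ {c}) = ν (Set.univ.pi A ×ˢ {c})) : μ = ν := by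
  have happ : ∀ (ρ : Measure ((∀ i, X i) × C)) (c : C) (s : Set (∀ i, X i)), MeasurableSet s →
      ((ρ.restrict (Prod.snd ⁻¹' {c})).map Prod.fst) s = ρ (s ×ˢ {c}) := by
    intro ρ c s hs
    rw [Measure.map_apply measurable_fst hs, Measure.restrict_apply (measurable_fst hs)]
    rfl
  have hsec : ∀ c, (μ.restrict (Prod.snd ⁻¹' {c})).map Prod.fst =
      (ν.restrict (Prod.snd ⁻¹' {c})).map Prod.fst := by
    intro c
    refine ext_of_generate_finite _ generateFrom_pi.symm isPiSystem_pi ?_ ?_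
    · rintro _ ⟨A, hA, rfl⟩
      have hA' : ∀ i, MeasurableSet (A i) := fun i => hA i (Set.mem_univ i)
      rw [happ _ _ _ (MeasurableSet.univ_pi hA'), happ _ _ _ (MeasurableSet.univ_pi hA'), h A hA']
    · rw [happ _ _ _ MeasurableSet.univ, happ _ _ _ MeasurableSet.univ, ← Set.pi_univ Set.univ]
      exact h _ (fun _ => MeasurableSet.univ) c
  refine Measure.ext_prod fun {s t} hs _ => ?_
  have hst : s ×ˢ t = ⋃ c ∈ t, s ×ˢ ({c} : Set C) := by
    rw [← Set.prod_iUnion₂, Set.biUnion_of_singleton]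
  have hsum : ∀ ρ : Measure ((∀ i, X i) × C), ρ (s ×ˢ t) = ∑' c : t, ρ (s ×ˢ {c.1}) := by
    intro ρ
    rw [hst]
    refine measure_biUnion t.to_countable (fun a _ b _ hab => ?_)
      fun c _ => hs.prod (measurableSet_singleton c)
    exact Set.disjoint_prod.2 (Or.inr (Set.disjoint_singleton.2 hab))
  rw [hsum, hsum]
  refine tsum_congr fun c => ?_
  rw [← happ _ _ _ hs, ← happ _ _ _ hs, hsec]

section Channel

variable {Y : Type*} [MeasurableSpace Y]

theorem virtualChannel_eq_iff (W : ZMod 2 → Measure Y) [∀ x, IsProbabilityMeasure (W x)]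
    {n : ℕ} (P : Pattern n) (i : Fin (2 ^ n)) :
    virtualChannel W P i 0 = virtualChannel W P i 1 ↔ NoInfluence (eventClass W) P i := by
  have h2 : ((2 : ℝ) ^ (2 ^ n - 1))⁻¹ ≠ 0 := by positivity
  constructor
  · intro h f hf c
    choose A _ hA' using hf
    obtain rfl : f = fun j x => (puncturedLaw W (P j) x).real (A j) := funext hA'
    have h0 := virtualChannel_pi_prod W P i 0 c A
    rw [h, virtualChannel_pi_prod W P i 1 c A] at h0
    exact (mul_left_cancel₀ h2 h0).symm
  · intro h
    refine measure_ext_pi_prod_singleton fun A hA c => ?_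
    -- The prefix is extended by `0`; the entries of `d` from `i` on play no role.
    obtain ⟨d, rfl⟩ : ∃ d : Fin (2 ^ n) → ZMod 2, c = fun j : {j // j < i} => d j :=
      ⟨fun j => if hj : j < i then c ⟨j, hj⟩ else 0, funext fun j => by simp [j.2]⟩
    refine (measureReal_eq_measureReal_iff).1 ?_
    rw [virtualChannel_pi_prod, virtualChannel_pi_prod, h _ fun j => ⟨A j, hA j, rfl⟩]

theorem erasurePattern_eq_true_iff (W : ZMod 2 → Measure Y) [∀ x, IsProbabilityMeasure (W x)]
    {n : ℕ} (P : Pattern n) (i : Fin (2 ^ n)) :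
    erasurePattern W P i = true ↔ NoInfluence (eventClass W) P i := by
  rw [erasurePattern, decide_eq_true_iff, symCapacity_eq_zero_iff, virtualChannel_eq_iff]

theorem const_one_mem_eventClass (W : ZMod 2 → Measure Y) [∀ x, IsProbabilityMeasure (W x)]
    (p : Bool) : (fun _ => 1) ∈ eventClass W p :=
  ⟨Set.univ, MeasurableSet.univ, by simp⟩

theorem eq_of_mem_eventClass_true {W : ZMod 2 → Measure Y} {f : ZMod 2 → ℝ}
    (hf : f ∈ eventClass W true) : f 0 = f 1 := by
  obtain ⟨A, _, rfl⟩ := hf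
  simp [puncturedLaw]

theorem exists_mem_eventClass_false {W : ZMod 2 → Measure Y} [∀ x, IsProbabilityMeasure (W x)]
    (hW : 0 < symCapacity W) : ∃ f ∈ eventClass W false, f 0 ≠ f 1 := by
  have hne : W 0 ≠ W 1 := fun h => hW.ne' ((symCapacity_eq_zero_iff W).2 h)
  by_contra! hc
  refine hne (Measure.ext fun s hs => ?_)
  have h := hc _ ⟨Sum.inl '' s, MeasurableSet.inl_image hs, rfl⟩
  simp only [puncturedLaw, Bool.false_eq_true, if_false] at h
  rw [measureReal_eq_measureReal_iff, Measure.map_apply measurable_inl hs.inl_image,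
    Measure.map_apply measurable_inl hs.inl_image,
    Set.preimage_image_eq _ Sum.inl_injective] at h
  exact h

/-! ### Recursion for the erasure pattern -/

theorem erasurePattern_zero {W : ZMod 2 → Measure Y} [∀ x, IsProbabilityMeasure (W x)]
    (hW : 0 < symCapacity W) (P : Pattern 0) : erasurePattern W P = P := by
  funext i
  rw [Bool.eq_iff_iff, erasurePattern_eq_true_iff,
    noInfluence_zero (fun _ => eq_of_mem_eventClass_true) (exists_mem_eventClass_false hW)]

theorem erasurePattern_evenPos (W : ZMod 2 → Measure Y) [∀ x, IsProbabilityMeasure (W x)]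
    {n : ℕ} (P : Pattern (n + 1)) (i : Fin (2 ^ n)) :
    erasurePattern W P (evenPos i) =
      (erasurePattern W (evenPart P) i || erasurePattern W (oddPart P) i) := by
  rw [Bool.eq_iff_iff, Bool.or_eq_true, erasurePattern_eq_true_iff, erasurePattern_eq_true_iff,
    erasurePattern_eq_true_iff, noInfluence_evenPos]

theorem erasurePattern_oddPos (W : ZMod 2 → Measure Y) [∀ x, IsProbabilityMeasure (W x)]
    {n : ℕ} (P : Pattern (n + 1)) (i : Fin (2 ^ n)) :
    erasurePattern W P (oddPos i) =
      (erasurePattern W (evenPart P) i && erasurePattern W (oddPart P) i) := by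
  rw [Bool.eq_iff_iff, Bool.and_eq_true, erasurePattern_eq_true_iff, erasurePattern_eq_true_iff,
    erasurePattern_eq_true_iff, noInfluence_oddPos (const_one_mem_eventClass W)]

/-- OR and AND of two bits have the same sum as the bits themselves, so the recursion preserves the
weight. -/
theorem sum_toNat_erasurePattern {W : ZMod 2 → Measure Y} [∀ x, IsProbabilityMeasure (W x)]
    (hW : 0 < symCapacity W) {n : ℕ} (P : Pattern n) :
    ∑ i, (erasurePattern W P i).toNat = ∑ i, (P i).toNat := by
  induction n with
  | zero => rw [erasurePattern_zero hW]
  | succ n ih =>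
    have h := congrArg₂ (· + ·) (ih (evenPart P)) (ih (oddPart P))
    rw [sum_parity, sum_parity fun i => (P i).toNat]
    refine Eq.trans ?_ h
    simp only [← Finset.sum_add_distrib, erasurePattern_evenPos, erasurePattern_oddPos]
    refine Finset.sum_congr rfl fun i _ => ?_
    cases erasurePattern W (evenPart P) i <;> cases erasurePattern W (oddPart P) i <;> rfl

/-! ### Symmetric patterns -/

theorem toNat_le_toNat_of_le {a b : Bool} (h : a ≤ b) : a.toNat ≤ b.toNat := by
  revert h
  cases a <;> cases b <;> decide

theorem pattern_eq_of_le_of_sum_eq {n : ℕ} {A B : Pattern n} (hle : ∀ i, A i ≤ B i)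
    (hsum : ∑ i, (A i).toNat = ∑ i, (B i).toNat) : A = B := by
  funext i
  have h := (Finset.sum_eq_sum_iff_of_le fun i _ => toNat_le_toNat_of_le (hle i)).1 hsum i
    (Finset.mem_univ i)
  revert h
  cases A i <;> cases B i <;> simp

/-- Symmetry alone gives only `E[P_e] ≤ P_e` and `P_o ≤ E[P_o]`; weight preservation turns both into
equalities. -/
theorem IsSymmetric.parts {W : ZMod 2 → Measure Y} [∀ x, IsProbabilityMeasure (W x)]
    (hW : 0 < symCapacity W) {n : ℕ} {P : Pattern (n + 1)} (hP : IsSymmetric W P) :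
    IsSymmetric W (evenPart P) ∧ IsSymmetric W (oddPart P) ∧
      ∀ i, oddPart P i ≤ evenPart P i := by
  have he : ∀ i, evenPart P i =
      (erasurePattern W (evenPart P) i || erasurePattern W (oddPart P) i) := fun i => by
    rw [← erasurePattern_evenPos, hP]
    rfl
  have ho : ∀ i, oddPart P i =
      (erasurePattern W (evenPart P) i && erasurePattern W (oddPart P) i) := fun i => by
    rw [← erasurePattern_oddPos, hP]
    rfl
  refine ⟨?_, ?_, fun i => ?_⟩
  · refine pattern_eq_of_le_of_sum_eq (fun i => ?_) (sum_toNat_erasurePattern hW _)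
    rw [he i]
    exact Bool.left_le_or _ _
  · refine (pattern_eq_of_le_of_sum_eq (fun i => ?_) (sum_toNat_erasurePattern hW _).symm).symm
    rw [ho i]
    exact Bool.and_le_right _ _
  · rw [he i, ho i]
    exact (Bool.and_le_left _ _).trans (Bool.left_le_or _ _)

theorem IsSymmetric.isPrimitive {W : ZMod 2 → Measure Y} [∀ x, IsProbabilityMeasure (W x)]
    (hW : 0 < symCapacity W) {n : ℕ} {P : Pattern n} (hP : IsSymmetric W P) : IsPrimitive P := by
  induction n with
  | zero => rw [isPrimitive_iff, sortPattern_zero]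
  | succ n ih =>
    obtain ⟨he, ho, hle⟩ := hP.parts hW
    exact isPrimitive_succ (ih he) (ih ho) hle

end Channel

end PolarCode

theorem mainTheorem6 {Y : Type*} [MeasurableSpace Y] (W : ZMod 2 → Measure Y)
    [∀ x, IsProbabilityMeasure (W x)] (hW : 0 < PolarCode.symCapacity W)
    (n : ℕ) (P : PolarCode.Pattern n) (hP : PolarCode.IsSymmetric W P) :
    PolarCode.IsPrimitive P ∧
      ∀ P' : PolarCode.Pattern n,
        PolarCode.Equivalent P P' → PolarCode.IsPrimitive P' → P' = P := by
  have hprim := hP.isPrimitive hW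
  refine ⟨hprim, fun P' hE hP' => ?_⟩
  calc P' = PolarCode.Phi P' := hP'.symm
    _ = PolarCode.Phi P := hE.phi_eq
    _ = P := hprim
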